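/- Let $T>0$, let $g\in C^7(\mathbb R)$ be $1$-periodic with $\int_0^1 g=0$, let $f:\mathbb R\to\mathbb R$ be continuous and $T$-periodic with $\int_0^T f=0$, and let $F$ be a primitive of $f$. Consider the system $$\dot Q=\frac{P+F(t)}{\sqrt{1+(P+F(t))^2}},\qquad \dot P=g(Q).$$ Let $N\ge 1$ be an integer and $L=T/N$, and assume $L<\pi/\sqrt{\|g'\|_\infty}$ (no condition if $g'\equiv 0$). Let $\tau\in\mathbb R$. Then for every $(Q_0,P_0)\in\mathbb R^2$ the system has exactly one solution $(Q,P)$ on $\mathbb R$ with $(Q(\tau),P(\tau))=(Q_0,P_0)$, and the map $$\Pi_{L,\tau}(Q_0,P_0)=(Q_1,P_1):=(Q(\tau+L),P(\tau+L))$$ belongs to the class $\mathcal P^{-L,L}$. That is, $\Pi_{L,\tau}$ satisfies $\Pi_{L,\tau}(Q_0+1,P_0)=\Pi_{L,\tau}(Q_0,P_0)+(1,0)$, it is the lift of a $C^2$ diffeomorphism of the cylinder $(\mathbb R/\mathbb Z)\times\mathbb R$, and: (1) it is isotopic to the identity, through a path of $C^2$ diffeomorphisms of the cylinder that is continuous together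 with its space derivatives up to order two; (2) it is exact symplectic: $P_1\,dQ_1-P_0\,dQ_0=dV$ for a function $V(Q_0,P_0)$ that is $1$-periodic in $Q_0$; (3) it is twist: $\partial Q_1/\partial P_0>0$ everywhere; (4) it preserves the ends: $P_1\to\pm\infty$ as $P_0\to\pm\infty$, uniformly in $Q_0$; (5) $Q_1-Q_0\to\pm L$ as $P_0\to\pm\infty$, uniformly in $Q_0$; (6) there is $M$ such that $|P_1-P_0|\le M$ for all $(Q_0,P_0)$. -/

import Mathlib

open Filter Topology

/-- `z = (Q, P)` is a (global) solution of the nonautonomous planar system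
`Q' = (P + F(t)) / √(1 + (P + F(t))²)`, `P' = g(Q)`. -/
def IsSolution (F g : ℝ → ℝ) (z : ℝ → ℝ × ℝ) : Prop :=
  ∀ t : ℝ, HasDerivAt z
    (((z t).2 + F t) / Real.sqrt (1 + ((z t).2 + F t) ^ 2), g (z t).1) t

/-- The time-`L` map `Π_{L,τ}` starting at time `τ`: it sends `(Q₀, P₀)` to the value at time
`τ + L` of the solution which equals `(Q₀, P₀)` at time `τ`.
(Meaningful when that solution exists and is unique.) -/
noncomputable def timeMap (F g : ℝ → ℝ) (L τ : ℝ) (x : ℝ × ℝ) : ℝ × ℝ :=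
  Classical.epsilon (fun z : ℝ → ℝ × ℝ => IsSolution F g z ∧ z τ = x) (τ + L)

/-- `f : ℝ² → ℝ²`, `(θ, r) ↦ (Θ, R)`, is a lift of a `C²` diffeomorphism of the cylinder
`(ℝ/ℤ) × ℝ`, with `Θ(θ + 1, r) = Θ(θ, r) + 1` and `R(θ + 1, r) = R(θ, r)`. -/
structure IsCylinderDiffeo (f : ℝ × ℝ → ℝ × ℝ) : Prop where
  contDiff : ContDiff ℝ 2 f
  exists_inverse : ∃ h : ℝ × ℝ → ℝ × ℝ,
    Function.LeftInverse h f ∧ Function.RightInverse h f ∧ ContDiff ℝ 2 h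
  periodic : ∀ θ r : ℝ, f (θ + 1, r) = f (θ, r) + (1, 0)

/-- The cylinder diffeomorphism with lift `f` is isotopic to the identity: there is a path
`H s`, `s ∈ [0, 1]`, of `C²` diffeomorphisms of the cylinder from the identity to `f`, which is
continuous for the `C²` topology (`H s x` and its derivatives in `x` up to order two are jointly
continuous in `(s, x)`). -/
def IsotopicToId (f : ℝ × ℝ → ℝ × ℝ) : Prop :=
  ∃ H : unitInterval → ℝ × ℝ → ℝ × ℝ,
    (∀ s, IsCylinderDiffeo (H s)) ∧ H 0 = id ∧ H 1 = f ∧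
    ∀ k : ℕ, k ≤ 2 →
      Continuous (fun p : unitInterval × (ℝ × ℝ) => iteratedFDeriv ℝ k (H p.1) p.2)

/-- The 1-form `R dΘ - r dθ` is exact on the cylinder: it is the differential `dV` of a function
`V(θ, r)` that is `1`-periodic in `θ`. -/
def IsExactSymplectic (f : ℝ × ℝ → ℝ × ℝ) : Prop :=
  ∃ V : ℝ × ℝ → ℝ, (∀ θ r : ℝ, V (θ + 1, r) = V (θ, r)) ∧
    ∀ x : ℝ × ℝ, HasFDerivAt V
      ((f x).2 • fderiv ℝ (fun y => (f y).1) x - x.2 • ContinuousLinearMap.fst ℝ ℝ ℝ) x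

/-- Twist: `∂Θ/∂r > 0` everywhere. -/
def IsTwist (f : ℝ × ℝ → ℝ × ℝ) : Prop :=
  ∀ θ r : ℝ, 0 < deriv (fun s => (f (θ, s)).1) r

/-- Preservation of the ends: `R(θ, r) → ±∞` as `r → ±∞`, uniformly in `θ`. -/
def PreservesEnds (f : ℝ × ℝ → ℝ × ℝ) : Prop :=
  (∀ M : ℝ, ∃ r₀ : ℝ, ∀ θ r : ℝ, r₀ ≤ r → M ≤ (f (θ, r)).2) ∧
  (∀ M : ℝ, ∃ r₀ : ℝ, ∀ θ r : ℝ, r ≤ r₀ → (f (θ, r)).2 ≤ M)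

/-- The class `𝒫` with limit rotations `ρplus` at `r → +∞` and `ρminus` at `r → -∞`, as a
condition on a lift `f`. -/
structure MemTwistClass (ρminus ρplus : ℝ) (f : ℝ × ℝ → ℝ × ℝ) : Prop where
  diffeo : IsCylinderDiffeo f
  isotopic : IsotopicToId f
  exact_symplectic : IsExactSymplectic f
  twist : IsTwist f
  preserves_ends : PreservesEnds f
  rotation_top : TendstoUniformly (fun r θ : ℝ => (f (θ, r)).1 - θ) (fun _ => ρplus) atTop
  rotation_bot : TendstoUniformly (fun r θ : ℝ => (f (θ, r)).1 - θ) (fun _ => ρminus) atBot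
  bounded_displacement : ∃ M : ℝ, ∀ θ r : ℝ, |(f (θ, r)).2 - r| ≤ M

/-! The velocity is bounded by 1 with derivative in (0, 1], and `g`, being periodic and C¹, is
bounded and Lipschitz. Hence solutions are global and unique; the time map is inverted by flowing
backwards and commutes with unit translations of Q. Over one step P moves by at most L·sup|g|, which
gives (4) and (6), and for large |P₀| the velocity stays near ±1 throughout the step, which gives
(5).

Smoothness comes from the implicit function theorem in C([0, 1]). After rescaling time, the position
curve is the unique zero of `pathDefect`, a smooth map because composition operators are smooth
(`contDiff_compOp`). Its partial derivative in the curve is the identity minus a Volterra-type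
operator, invertible whatever the size of L (`isUnit_one_sub_volterra`). The solution curve is
therefore a C² function of the initial data, and evaluating it at s ∈ [0, 1] yields the isotopy.

For the twist, A = ∂Q/∂P₀ and B = ∂P/∂P₀ satisfy A' = pB, B' = qA with A(0) = 0, B(0) = 1, 0 < p ≤ L
and q ≥ -L·sup|g'|. Sturm comparison with a harmonic oscillator keeps A positive up to time 1 when
L·√(sup|g'|) < π (`pos_of_sturm_comparison`).

The system is Hamiltonian with H = √(1 + (P + F)²) - G(Q), G' = g. The generating function V is the
action ∫ P dQ - H dt (`hasFDerivAt_actionAlong`); it is periodic because the zero mean of `g` makes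
G periodic. -/

/-! ### Volterra operators and exponentially weighted norms. -/

/-- The Volterra operator `u ↦ (s ↦ ∫ r in 0..s, u r)` on `C([0, 1], ℝ)`. -/
noncomputable def volterra : C(unitInterval, ℝ) →L[ℝ] C(unitInterval, ℝ) :=
  LinearMap.mkContinuous
    { toFun := fun u =>
        ⟨fun s => ∫ r in (0 : ℝ)..s, u (Set.projIcc 0 1 zero_le_one r), by
          have h : Continuous fun t : ℝ => ∫ r in (0 : ℝ)..t, u (Set.projIcc 0 1 zero_le_one r) :=
            intervalIntegral.continuous_primitive
              (fun a b => ((u.continuous.comp continuous_projIcc).intervalIntegrable a b)) 0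
          exact h.comp continuous_subtype_val⟩
      map_add' := fun u v => by
        ext s
        exact intervalIntegral.integral_add
          ((u.continuous.comp continuous_projIcc).intervalIntegrable _ _)
          ((v.continuous.comp continuous_projIcc).intervalIntegrable _ _)
      map_smul' := fun c u => by
        ext s
        exact intervalIntegral.integral_const_mul c _ }
    1 fun u => by
      rw [one_mul, ContinuousMap.norm_le _ (norm_nonneg u)]
      intro s
      have := intervalIntegral.norm_integral_le_of_norm_le_const (a := (0 : ℝ)) (b := s)
        (f := fun r => u (Set.projIcc 0 1 zero_le_one r)) (C := ‖u‖)
        fun r _ => u.norm_coe_le_norm _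
      refine this.trans ?_
      rw [sub_zero, abs_of_nonneg s.2.1]
      exact mul_le_of_le_one_right (norm_nonneg u) s.2.2

theorem volterra_apply (u : C(unitInterval, ℝ)) (s : unitInterval) :
    volterra u s = ∫ r in (0 : ℝ)..s, u (Set.projIcc 0 1 zero_le_one r) := rfl

/-- A function of the form `c + ∫ w` extends to a differentiable function on the line. -/
theorem exists_hasDerivAt_of_eq_volterra {u w : C(unitInterval, ℝ)} {c : ℝ}
    (h : ∀ s, u s = c + volterra w s) :
    ∃ U : ℝ → ℝ, (∀ t, HasDerivAt U (w (Set.projIcc 0 1 zero_le_one t)) t) ∧ U 0 = c ∧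
      ∀ s : unitInterval, U s = u s := by
  refine ⟨fun t => c + ∫ r in (0 : ℝ)..t, w (Set.projIcc 0 1 zero_le_one r), fun t => ?_, by simp,
    fun s => by rw [h, volterra_apply]⟩
  have hc : Continuous fun r : ℝ => w (Set.projIcc 0 1 zero_le_one r) :=
    w.continuous.comp continuous_projIcc
  exact (intervalIntegral.integral_hasDerivAt_right (hc.intervalIntegrable _ _)
    hc.stronglyMeasurable.stronglyMeasurableAtFilter hc.continuousAt).const_add c

/-- The exponential weight `s ↦ exp (k s)` on `[0, 1]`. -/
noncomputable def expWeight (k : ℝ) : C(unitInterval, ℝ) :=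
  ⟨fun s => Real.exp (k * s), by fun_prop⟩

theorem expWeight_apply (k : ℝ) (s : unitInterval) : expWeight k s = Real.exp (k * s) := rfl

theorem expWeight_neg_mul (k : ℝ) : expWeight (-k) * expWeight k = 1 := by
  ext s
  simp [expWeight_apply, ← Real.exp_add]

/-- Bielecki's trick: in the norm weighted by exp(-ks), integration has norm at most 1/k, because
the integral of exp(kr) over [0, s] is at most exp(ks)/k. A large k thus replaces any smallness
assumption on L. -/
theorem norm_expWeight_neg_mul_volterra_le {k : ℝ} (hk : 0 < k) (u : C(unitInterval, ℝ)) :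
    ‖expWeight (-k) * volterra u‖ ≤ k⁻¹ * ‖expWeight (-k) * u‖ := by
  set C := ‖expWeight (-k) * u‖
  have hC : 0 ≤ C := norm_nonneg _
  rw [ContinuousMap.norm_le _ (by positivity)]
  intro s
  have hu : ∀ r ∈ Set.Ioc (0 : ℝ) s, ‖u (Set.projIcc 0 1 zero_le_one r)‖ ≤ C * Real.exp (k * r) := by
    intro r hr
    have hr' : r ∈ Set.Icc (0 : ℝ) 1 := ⟨hr.1.le, hr.2.trans s.2.2⟩
    rw [Set.projIcc_of_mem _ hr']
    have := (expWeight (-k) * u).norm_coe_le_norm ⟨r, hr'⟩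
    rw [ContinuousMap.mul_apply, expWeight_apply, norm_mul, Real.norm_of_nonneg (Real.exp_pos _).le]
      at this
    calc ‖u ⟨r, hr'⟩‖ = Real.exp (-k * r) * ‖u ⟨r, hr'⟩‖ * Real.exp (k * r) := by
          rw [mul_right_comm, ← Real.exp_add]; simp
      _ ≤ C * Real.exp (k * r) := by gcongr
  have hint : ∫ r in (0 : ℝ)..s, C * Real.exp (k * r) = C * (k⁻¹ * (Real.exp (k * s) - 1)) := by
    rw [intervalIntegral.integral_const_mul, intervalIntegral.integral_comp_mul_left _ hk.ne']
    simp
  have h1 := intervalIntegral.norm_integral_le_of_norm_le (a := (0 : ℝ)) (b := s) (μ := MeasureTheory.volume) s.2.1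
    (Filter.Eventually.of_forall hu) ((by fun_prop : Continuous fun r : ℝ =>
      C * Real.exp (k * r)).intervalIntegrable _ _)
  rw [hint] at h1
  rw [ContinuousMap.mul_apply, expWeight_apply, norm_mul, Real.norm_of_nonneg (Real.exp_pos _).le,
    volterra_apply]
  calc _ ≤ Real.exp (-k * s) * (C * (k⁻¹ * (Real.exp (k * s) - 1))) := by gcongr
    _ = k⁻¹ * C * (1 - Real.exp (-k * s)) := by
      have : Real.exp (-k * s) * Real.exp (k * s) = 1 := by rw [← Real.exp_add]; simp
      linear_combination (C * k⁻¹) * this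
    _ ≤ k⁻¹ * C := by
      refine mul_le_of_le_one_right (by positivity) ?_
      linarith [Real.exp_pos (-k * s)]

theorem norm_le_of_pointwise {u v : C(unitInterval, ℝ)} {c : ℝ} (hc : 0 ≤ c)
    (h : ∀ s, |u s| ≤ c * |v s|) (e : C(unitInterval, ℝ)) : ‖e * u‖ ≤ c * ‖e * v‖ := by
  rw [ContinuousMap.norm_le _ (by positivity)]
  intro s
  calc ‖(e * u) s‖ = |e s| * |u s| := by simp
    _ ≤ |e s| * (c * |v s|) := by gcongr; exact h s
    _ = c * ‖(e * v) s‖ := by simp; ring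
    _ ≤ c * ‖e * v‖ := by gcongr; exact (e * v).norm_coe_le_norm s

/-- Multiplication by a continuous function on `[0, 1]`. -/
noncomputable abbrev mulOp (a : C(unitInterval, ℝ)) : C(unitInterval, ℝ) →L[ℝ] C(unitInterval, ℝ) :=
  ContinuousLinearMap.mul ℝ C(unitInterval, ℝ) a

theorem isUnit_one_sub_volterra (a b : C(unitInterval, ℝ)) :
    IsUnit (1 - volterra * mulOp a * (volterra * mulOp b)) := by
  obtain ⟨k, hk, hk1⟩ : ∃ k : ℝ, 0 < k ∧ k⁻¹ * ‖a‖ * (k⁻¹ * ‖b‖) < 1 := by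
    refine ⟨‖a‖ + ‖b‖ + 1, by positivity, ?_⟩
    have h : ∀ x y : ℝ, 0 ≤ x → 0 ≤ y → (x + y + 1)⁻¹ * x < 1 := fun x y hx hy => by
      rw [inv_mul_lt_iff₀ (by positivity)]; linarith
    have hb := h ‖b‖ ‖a‖ (norm_nonneg _) (norm_nonneg _)
    rw [add_comm ‖b‖] at hb
    exact mul_lt_one_of_nonneg_of_lt_one_left (by positivity) (h _ _ (norm_nonneg _)
      (norm_nonneg _)) hb.le
  have hu : expWeight k * expWeight (-k) = 1 := by rw [mul_comm, expWeight_neg_mul]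
  -- Conjugating by the weight turns the weighted estimate into an ordinary operator norm bound, so
  -- the Neumann series applies to the conjugated operator.
  let U : (C(unitInterval, ℝ) →L[ℝ] C(unitInterval, ℝ))ˣ :=
    ⟨mulOp (expWeight k), mulOp (expWeight (-k)), by
      ext u s; simp [← mul_assoc, hu],
      by ext u s; simp [← mul_assoc, expWeight_neg_mul]⟩
  set K := volterra * mulOp a * (volterra * mulOp b)
  have hv : ∀ (c u : C(unitInterval, ℝ)), ‖expWeight (-k) * volterra (c * u)‖
      ≤ k⁻¹ * ‖c‖ * ‖expWeight (-k) * u‖ := by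
    intro c u
    refine (norm_expWeight_neg_mul_volterra_le hk _).trans ?_
    rw [mul_assoc]
    gcongr
    refine norm_le_of_pointwise (norm_nonneg c) (fun s => ?_) _
    rw [ContinuousMap.mul_apply, abs_mul]
    gcongr
    exact c.norm_coe_le_norm s
  have hK : ‖(↑U⁻¹ : C(unitInterval, ℝ) →L[ℝ] C(unitInterval, ℝ)) * K * U‖ < 1 := by
    refine (ContinuousLinearMap.opNorm_le_bound _ (by positivity) fun u => ?_).trans_lt hk1
    change ‖expWeight (-k) * volterra (a * volterra (b * (expWeight k * u)))‖ ≤ _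
    calc _ ≤ k⁻¹ * ‖a‖ * (k⁻¹ * ‖b‖ * ‖expWeight (-k) * (expWeight k * u)‖) :=
          (hv _ _).trans (by gcongr; exact hv _ _)
      _ = _ := by rw [← mul_assoc (expWeight (-k)), expWeight_neg_mul, one_mul]; ring
  have h1 : IsUnit (1 - (↑U⁻¹ : C(unitInterval, ℝ) →L[ℝ] C(unitInterval, ℝ)) * K * U) :=
    isUnit_one_sub_of_norm_lt_one (R := C(unitInterval, ℝ) →L[ℝ] C(unitInterval, ℝ)) hK
  have h2 : 1 - K = U * (1 - ↑U⁻¹ * K * U) * ↑U⁻¹ := by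
    simp [mul_sub, sub_mul, mul_assoc]
  rw [h2]
  exact (U.isUnit.mul h1).mul U⁻¹.isUnit

/-! ### Smoothness of composition operators. -/

/-- The composition (Nemytskii) operator `u ↦ h ∘ u` on `C([0, 1], ℝ)`. -/
def compOp (h : C(ℝ, ℝ)) (u : C(unitInterval, ℝ)) : C(unitInterval, ℝ) := h.comp u

theorem compOp_apply (h : C(ℝ, ℝ)) (u : C(unitInterval, ℝ)) (s : unitInterval) :
    compOp h u s = h (u s) := rfl

theorem hasFDerivAt_compOp {h h' : C(ℝ, ℝ)} (hh : ∀ x, HasDerivAt h (h' x) x)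
    (u : C(unitInterval, ℝ)) : HasFDerivAt (compOp h) (mulOp (compOp h' u)) u := by
  rw [hasFDerivAt_iff_isLittleO, Asymptotics.isLittleO_iff]
  intro c hc
  -- For `v` within distance 1 of `u`, both curves take values in this compact ball, so one modulus
  -- of continuity of `h'` serves all `s`.
  have huc : UniformContinuousOn h' (Metric.closedBall (0 : ℝ) (‖u‖ + 1)) :=
    (isCompact_closedBall _ _).uniformContinuousOn_of_continuous h'.continuous.continuousOn
  rw [Metric.uniformContinuousOn_iff] at huc
  obtain ⟨d, hd, hd'⟩ := huc c hc
  filter_upwards [Metric.ball_mem_nhds u (lt_min hd one_pos)] with v hv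
  rw [Metric.mem_ball, dist_eq_norm, lt_min_iff] at hv
  rw [ContinuousMap.norm_le _ (by positivity)]
  intro s
  have hus : |u s| ≤ ‖u‖ := u.norm_coe_le_norm s
  have hvs : |v s - u s| ≤ ‖v - u‖ := (v - u).norm_coe_le_norm s
  have key := (convex_segment (𝕜 := ℝ) (u s) (v s)).norm_image_sub_le_of_norm_hasDerivWithin_le
    (f := fun y => h y - h' (u s) * y) (f' := fun y => h' y - h' (u s)) (C := c)
    (fun y _ => (((hh y).sub ((hasDerivAt_id y).const_mul _)).congr_deriv
      (by simp)).hasDerivWithinAt)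
    (fun y hy => by
      have hy' : |y - u s| ≤ |v s - u s| := by
        have := segment_subset_closedBall_left (u s) (v s) hy
        rwa [Metric.mem_closedBall, dist_comm (u s), Real.dist_eq, Real.dist_eq] at this
      rw [← dist_eq_norm]
      refine (hd' y ?_ (u s) ?_ ?_).le
      · rw [mem_closedBall_zero_iff, Real.norm_eq_abs]
        have := abs_add_le (y - u s) (u s)
        rw [sub_add_cancel] at this
        linarith
      · rw [mem_closedBall_zero_iff, Real.norm_eq_abs]; linarith
      · rw [Real.dist_eq]; linarith)
    (left_mem_segment ℝ _ _) (right_mem_segment ℝ _ _)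
  calc _ = ‖h (v s) - h' (u s) * v s - (h (u s) - h' (u s) * u s)‖ := by
        congr 1
        simp [compOp_apply]; ring
    _ ≤ c * ‖v s - u s‖ := key
    _ ≤ c * ‖v - u‖ := by gcongr; exact hvs

/-- Induction on the order: the derivative at `u` is multiplication by `h' ∘ u`, that is, a bounded
linear map applied to the composition operator of `h'`. -/
theorem contDiff_compOp {n : ℕ} (h : C(ℝ, ℝ)) (hh : ContDiff ℝ n h) :
    ContDiff ℝ n (compOp h) := by
  induction n generalizing h with
  | zero => exact contDiff_zero.2 (ContinuousMap.continuous_postcomp h)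
  | succ n ih =>
    rw [Nat.cast_succ] at hh ⊢
    have hd : ContDiff ℝ n (deriv h) := (contDiff_succ_iff_deriv.1 hh).2.2
    have hdiff : Differentiable ℝ h := (contDiff_succ_iff_deriv.1 hh).1
    rw [contDiff_succ_iff_hasFDerivAt]
    let h' : C(ℝ, ℝ) := ⟨deriv h, hd.continuous⟩
    refine ⟨fun u => mulOp (compOp h' u), ?_, fun u => hasFDerivAt_compOp (fun x =>
      (hdiff x).hasDerivAt) u⟩
    have hm : ContDiff ℝ n fun a : C(unitInterval, ℝ) => mulOp a :=
      ContinuousLinearMap.contDiff (𝕜 := ℝ) (E := C(unitInterval, ℝ))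
        (F := C(unitInterval, ℝ) →L[ℝ] C(unitInterval, ℝ)) (ContinuousLinearMap.mul ℝ _)
    exact hm.comp (ih h' hd)

/-! ### The relativistic velocity. -/

theorem one_add_sq_pos (u : ℝ) : 0 < 1 + u ^ 2 := by positivity

theorem hasDerivAt_sqrt_one_add_sq (u : ℝ) :
    HasDerivAt (fun u : ℝ => Real.sqrt (1 + u ^ 2)) (u / Real.sqrt (1 + u ^ 2)) u := by
  have h := (((hasDerivAt_id u).pow 2).const_add 1).sqrt (one_add_sq_pos u).ne'
  refine h.congr_deriv ?_
  simp
  ring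

/-- The relativistic velocity `u ↦ u / √(1 + u²)` as a function of the momentum. -/
noncomputable def velocity : C(ℝ, ℝ) :=
  ⟨fun u => u / Real.sqrt (1 + u ^ 2), continuous_id.div (by fun_prop)
    fun u => (Real.sqrt_pos.2 (one_add_sq_pos u)).ne'⟩

/-- The derivative of the relativistic velocity. -/
noncomputable def velocityDeriv : C(ℝ, ℝ) :=
  ⟨fun u => 1 / Real.sqrt (1 + u ^ 2) ^ 3, continuous_const.div (by fun_prop)
    fun u => (pow_pos (Real.sqrt_pos.2 (one_add_sq_pos u)) 3).ne'⟩

theorem velocity_apply (u : ℝ) : velocity u = u / Real.sqrt (1 + u ^ 2) := rfl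

theorem hasDerivAt_velocity (u : ℝ) : HasDerivAt velocity (velocityDeriv u) u := by
  have h0 := Real.sqrt_pos.2 (one_add_sq_pos u)
  have h := (hasDerivAt_id u).div (hasDerivAt_sqrt_one_add_sq u) h0.ne'
  refine h.congr_deriv ?_
  have h2 := Real.sq_sqrt (one_add_sq_pos u).le
  change _ = 1 / Real.sqrt (1 + u ^ 2) ^ 3
  simp only [id]
  field_simp
  linarith

theorem velocityDeriv_pos (u : ℝ) : 0 < velocityDeriv u :=
  one_div_pos.2 (pow_pos (Real.sqrt_pos.2 (one_add_sq_pos u)) 3)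

theorem velocityDeriv_le_one (u : ℝ) : velocityDeriv u ≤ 1 := by
  have h : 1 ≤ Real.sqrt (1 + u ^ 2) := Real.one_le_sqrt.2 (by nlinarith [sq_nonneg u])
  exact div_le_one_of_le₀ (one_le_pow₀ h) (by positivity)

theorem contDiff_velocity {n : WithTop ℕ∞} : ContDiff ℝ n velocity :=
  contDiff_id.div ((contDiff_const.add (contDiff_id.pow 2)).sqrt fun u => (one_add_sq_pos u).ne')
    fun u => (Real.sqrt_pos.2 (one_add_sq_pos u)).ne'

theorem lipschitzWith_velocity : LipschitzWith 1 velocity :=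
  lipschitzWith_of_nnnorm_deriv_le (fun u => (hasDerivAt_velocity u).differentiableAt) fun u => by
    rw [(hasDerivAt_velocity u).deriv, ← NNReal.coe_le_coe, coe_nnnorm, Real.norm_eq_abs,
      abs_of_pos (velocityDeriv_pos u)]
    exact velocityDeriv_le_one u

theorem strictMono_velocity : StrictMono velocity :=
  strictMono_of_deriv_pos fun u => by
    rw [(hasDerivAt_velocity u).deriv]; exact velocityDeriv_pos u

theorem abs_velocity_le_one (u : ℝ) : |velocity u| ≤ 1 := by
  have h0 := Real.sqrt_pos.2 (one_add_sq_pos u)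
  rw [velocity_apply, abs_div, abs_of_pos h0, div_le_one h0]
  exact Real.abs_le_sqrt (by linarith)

theorem velocity_neg (u : ℝ) : velocity (-u) = -velocity u := by
  simp [velocity_apply, neg_div]

theorem one_sub_inv_le_velocity {u : ℝ} (hu : 0 < u) : 1 - u⁻¹ ≤ velocity u := by
  have h0 := Real.sqrt_pos.2 (one_add_sq_pos u)
  have h1 : Real.sqrt (1 + u ^ 2) ≤ 1 + u := by
    rw [Real.sqrt_le_left (by linarith)]; nlinarith
  have h2 : u / (1 + u) ≤ velocity u := by
    rw [velocity_apply]; gcongr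
  refine le_trans ?_ h2
  rw [le_div_iff₀ (by linarith)]
  field_simp
  nlinarith

theorem tendsto_velocity_atTop : Tendsto velocity atTop (𝓝 1) := by
  have h : Tendsto (fun u : ℝ => 1 - u⁻¹) atTop (𝓝 1) := by
    simpa using tendsto_inv_atTop_zero.const_sub (1 : ℝ)
  refine tendsto_of_tendsto_of_tendsto_of_le_of_le' h tendsto_const_nhds ?_
    (Eventually.of_forall fun u => (le_abs_self _).trans (abs_velocity_le_one u))
  filter_upwards [eventually_gt_atTop 0] with u hu using one_sub_inv_le_velocity hu

theorem tendsto_velocity_atBot : Tendsto velocity atBot (𝓝 (-1)) := by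
  have h := (tendsto_velocity_atTop.comp tendsto_neg_atBot_atTop).neg
  refine h.congr fun u => ?_
  simp [velocity_neg]

/-! ### Global existence and uniqueness. -/

/-- A bounded, uniformly Lipschitz nonautonomous vector field has unique global solutions. -/
theorem existsUnique_solution_of_bounded_lipschitz {E : Type*} [NormedAddCommGroup E]
    [NormedSpace ℝ E] [CompleteSpace E] {v : ℝ → E → E} {K C : NNReal}
    (hK : ∀ t, LipschitzWith K (v t)) (hv : ∀ x, Continuous fun t => v t x)
    (hC : ∀ t x, ‖v t x‖ ≤ C) (τ : ℝ) (x : E) :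
    ∃! z : ℝ → E, (∀ t, HasDerivAt z (v t (z t)) t) ∧ z τ = x := by
  have hloc : ∀ n : ℕ, ∃ z : ℝ → E, z τ = x ∧
      ∀ t ∈ Set.Ioo (τ - (n + 1)) (τ + (n + 1)), HasDerivAt z (v t (z t)) t := by
    intro n
    have hn : (0 : ℝ) < n + 1 := by positivity
    -- A solution moves by at most C(n + 1) in time n + 1, so a ball of that radius satisfies the
    -- Picard–Lindelöf condition with no restriction on the time interval.
    have hpl : IsPicardLindelof v (tmin := τ - (n + 1)) (tmax := τ + (n + 1))
        ⟨τ, by constructor <;> linarith⟩ x (C * (n + 1)) 0 C K :=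
      { lipschitzOnWith := fun t _ => (hK t).lipschitzOnWith
        continuousOn := fun x _ => (hv x).continuousOn
        norm_le := fun t _ x _ => hC t x
        mul_max_le := by simp }
    obtain ⟨z, hz, hz'⟩ := hpl.exists_eq_forall_mem_Icc_hasDerivWithinAt₀
    exact ⟨z, hz, fun t ht => (hz' t (Set.Ioo_subset_Icc_self ht)).hasDerivAt
      (Icc_mem_nhds ht.1 ht.2)⟩
  choose z hz hz' using hloc
  have hagree : ∀ m n : ℕ, m ≤ n → Set.EqOn (z m) (z n) (Set.Ioo (τ - (m + 1)) (τ + (m + 1))) := by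
    intro m n hmn
    have hmn' : (m : ℝ) ≤ n := by exact_mod_cast hmn
    have hm : (0 : ℝ) < m + 1 := by positivity
    refine ODE_solution_unique_of_mem_Ioo (s := fun _ => Set.univ) (t₀ := τ)
      (fun t _ => (hK t).lipschitzOnWith) ⟨by linarith, by linarith⟩
      (fun t ht => ⟨hz' m t ht, trivial⟩)
      (fun t ht => ⟨hz' n t ⟨by linarith [ht.1], by linarith [ht.2]⟩, trivial⟩) ?_
    rw [hz, hz]
  -- The half-width is `n + 1`, so t lies strictly inside the open interval of index ⌈|t - τ|⌉ and a
  -- single local solution covers a neighbourhood of t.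
  let idx : ℝ → ℕ := fun t => ⌈|t - τ|⌉₊
  have hidx : ∀ t (n : ℕ), idx t ≤ n → t ∈ Set.Ioo (τ - (n + 1)) (τ + (n + 1)) := by
    intro t n hn
    have h1 : |t - τ| ≤ n := (Nat.le_ceil _).trans (by exact_mod_cast hn)
    have := abs_le.1 h1
    constructor <;> linarith
  refine ⟨fun t => z (idx t) t, ⟨fun t => ?_, ?_⟩, fun y hy => ?_⟩
  · have hmem := hidx t (idx t) le_rfl
    have hev : (fun s => z (idx s) s) =ᶠ[𝓝 t] z (idx t) := by
      filter_upwards [Ioo_mem_nhds hmem.1 hmem.2] with s hs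
      rcases le_total (idx s) (idx t) with h | h
      · exact hagree _ _ h (hidx s _ le_rfl)
      · exact (hagree _ _ h hs).symm
    exact (hz' (idx t) t hmem).congr_of_eventuallyEq hev
  · exact hz _
  · funext t
    refine ODE_solution_unique_of_mem_Ioo (s := fun _ => Set.univ) (t₀ := τ)
      (a := τ - (idx t + 1)) (b := τ + (idx t + 1))
      (fun t _ => (hK t).lipschitzOnWith) ⟨?_, ?_⟩
      (fun t ht => ⟨hy.1 t, trivial⟩)
      (fun t ht => ⟨hz' _ t ht, trivial⟩) (hy.2.trans (hz _).symm) (hidx t _ le_rfl)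
    all_goals
      have : (0 : ℝ) < idx t + 1 := by positivity
      linarith

theorem existsUnique_isSolution {F g : ℝ → ℝ} {K C : NNReal} (hF : Continuous F)
    (hK : LipschitzWith K g) (hC : ∀ x, |g x| ≤ C) (τ : ℝ) (x : ℝ × ℝ) :
    ∃! z : ℝ → ℝ × ℝ, IsSolution F g z ∧ z τ = x := by
  refine existsUnique_solution_of_bounded_lipschitz
    (v := fun t z => (velocity (z.2 + F t), g z.1)) (K := max 1 K) (C := max 1 C)
    (fun t => ?_) (fun z => by fun_prop) (fun t z => ?_) τ x
  · have h1 : LipschitzWith 1 fun z : ℝ × ℝ => velocity (z.2 + F t) :=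
      LipschitzWith.of_dist_le_mul fun z w => by
        refine (lipschitzWith_velocity.dist_le_mul _ _).trans ?_
        rw [dist_add_right]
        gcongr
        exact le_max_right _ _
    have h2 : LipschitzWith K fun z : ℝ × ℝ => g z.1 := by
      simpa [Function.comp_def] using hK.comp LipschitzWith.prod_fst
    exact h1.prodMk h2
  · rw [Prod.norm_mk]
    exact max_le_max (abs_velocity_le_one _) (hC _)

/-! ### Flow properties of the time map and its behaviour at the ends. -/

section Flow

variable {F g : ℝ → ℝ}

/-- All initial value problems have exactly one global solution. -/
def WellPosed (F g : ℝ → ℝ) : Prop :=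
  ∀ (τ : ℝ) (x : ℝ × ℝ), ∃! z : ℝ → ℝ × ℝ, IsSolution F g z ∧ z τ = x

theorem WellPosed.timeMap_eq (hw : WellPosed F g) {z : ℝ → ℝ × ℝ} (hz : IsSolution F g z)
    (τ L : ℝ) : timeMap F g L τ (z τ) = z (τ + L) := by
  have h := Classical.epsilon_spec (p := fun y : ℝ → ℝ × ℝ => IsSolution F g y ∧ y τ = z τ)
    ⟨z, hz, rfl⟩
  have := (hw τ (z τ)).unique h ⟨hz, rfl⟩
  exact congrFun this _

theorem WellPosed.exists_isSolution_timeMap (hw : WellPosed F g) (τ : ℝ) (x : ℝ × ℝ) :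
    ∃ z : ℝ → ℝ × ℝ, IsSolution F g z ∧ z τ = x ∧ ∀ L, timeMap F g L τ x = z (τ + L) := by
  obtain ⟨z, ⟨hz, rfl⟩, -⟩ := hw τ x
  exact ⟨z, hz, rfl, hw.timeMap_eq hz τ⟩

theorem WellPosed.timeMap_zero (hw : WellPosed F g) (τ : ℝ) (x : ℝ × ℝ) :
    timeMap F g 0 τ x = x := by
  obtain ⟨z, -, h0, h⟩ := hw.exists_isSolution_timeMap τ x
  rw [h, add_zero, h0]

theorem WellPosed.timeMap_neg_timeMap (hw : WellPosed F g) (τ L : ℝ) (x : ℝ × ℝ) :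
    timeMap F g (-L) (τ + L) (timeMap F g L τ x) = x := by
  obtain ⟨z, hz, h0, h⟩ := hw.exists_isSolution_timeMap τ x
  rw [h, hw.timeMap_eq hz, add_neg_cancel_right, h0]

theorem WellPosed.timeMap_timeMap_neg (hw : WellPosed F g) (τ L : ℝ) (x : ℝ × ℝ) :
    timeMap F g L τ (timeMap F g (-L) (τ + L) x) = x := by
  have := hw.timeMap_neg_timeMap (τ + L) (-L) x
  rwa [add_neg_cancel_right, neg_neg] at this

theorem WellPosed.timeMap_periodic (hw : WellPosed F g) (hg : ∀ x, g (x + 1) = g x) (τ L θ r : ℝ) :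
    timeMap F g L τ (θ + 1, r) = timeMap F g L τ (θ, r) + (1, 0) := by
  obtain ⟨z, hz, h0, h⟩ := hw.exists_isSolution_timeMap τ (θ, r)
  have hz' : IsSolution F g fun t => z t + (1, 0) := fun t =>
    ((hz t).add_const (1, 0)).congr_deriv (by simp [hg])
  have := hw.timeMap_eq hz' τ L
  simp only [h0] at this
  rw [h, ← this]
  simp

theorem IsSolution.hasDerivAt_fst {z : ℝ → ℝ × ℝ} (hz : IsSolution F g z) (t : ℝ) :
    HasDerivAt (fun t => (z t).1) (velocity ((z t).2 + F t)) t :=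
  (hz t).fst

theorem IsSolution.hasDerivAt_snd {z : ℝ → ℝ × ℝ} (hz : IsSolution F g z) (t : ℝ) :
    HasDerivAt (fun t => (z t).2) (g (z t).1) t :=
  (hz t).snd

theorem IsSolution.continuous {z : ℝ → ℝ × ℝ} (hz : IsSolution F g z) : Continuous z :=
  continuous_iff_continuousAt.2 fun t => (hz t).continuousAt

theorem IsSolution.abs_snd_sub_le {z : ℝ → ℝ × ℝ} (hz : IsSolution F g z) {C : ℝ}
    (hC : ∀ x, |g x| ≤ C) (s t : ℝ) : |(z t).2 - (z s).2| ≤ C * |t - s| :=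
  convex_univ.norm_image_sub_le_of_norm_hasDerivWithin_le
    (fun t _ => (hz.hasDerivAt_snd t).hasDerivWithinAt) (fun _ _ => hC _) trivial trivial

theorem WellPosed.abs_timeMap_snd_sub_le (hw : WellPosed F g) {C : ℝ} (hC : ∀ x, |g x| ≤ C)
    (τ L θ r : ℝ) : |(timeMap F g L τ (θ, r)).2 - r| ≤ C * |L| := by
  obtain ⟨z, hz, h0, h⟩ := hw.exists_isSolution_timeMap τ (θ, r)
  have := hz.abs_snd_sub_le hC τ (τ + L)
  simpa [h, h0] using this

theorem WellPosed.preservesEnds_timeMap (hw : WellPosed F g) {C : ℝ} (hC : ∀ x, |g x| ≤ C)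
    (τ L : ℝ) : PreservesEnds (timeMap F g L τ) := by
  constructor
  · refine fun M => ⟨M + C * |L|, fun θ r hr => ?_⟩
    linarith [(abs_le.1 (hw.abs_timeMap_snd_sub_le hC τ L θ r)).1]
  · refine fun M => ⟨M - C * |L|, fun θ r hr => ?_⟩
    linarith [(abs_le.1 (hw.abs_timeMap_snd_sub_le hC τ L θ r)).2]

/-- The displacement of the position over a time step is squeezed between the displacements at
the extreme velocities. -/
theorem WellPosed.exists_timeMap_fst_sub_mem (hw : WellPosed F g) (hF : Continuous F) {C : ℝ}
    (hC : ∀ x, |g x| ≤ C) (τ : ℝ) {L : ℝ} (hL : 0 ≤ L) :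
    ∃ B : ℝ, ∀ θ r : ℝ, (timeMap F g L τ (θ, r)).1 - θ ∈
      Set.Icc (L * velocity (r - B)) (L * velocity (r + B)) := by
  obtain ⟨D, hD⟩ := (isCompact_Icc (a := τ) (b := τ + L)).exists_bound_of_continuousOn
    hF.continuousOn
  have hC0 : 0 ≤ C := (abs_nonneg _).trans (hC 0)
  -- `C * L` bounds the drift of the momentum over the step and `D` bounds |F| on [τ, τ + L].
  refine ⟨C * L + D, fun θ r => ?_⟩
  obtain ⟨z, hz, h0, h⟩ := hw.exists_isSolution_timeMap τ (θ, r)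
  have hv : ∀ t ∈ Set.Icc τ (τ + L), |(z t).2 + F t - r| ≤ C * L + D := by
    intro t ht
    have h1 := hz.abs_snd_sub_le hC τ t
    rw [h0, abs_of_nonneg (sub_nonneg.2 ht.1)] at h1
    have h2 : C * (t - τ) ≤ C * L := by gcongr; linarith [ht.2]
    have h3 := hD t ht
    rw [Real.norm_eq_abs] at h3
    have h4 := abs_add_le ((z t).2 - r) (F t)
    rw [show (z t).2 + F t - r = (z t).2 - r + F t by ring]
    linarith
  have hcont : ContinuousOn (fun t => (z t).1) (Set.Icc τ (τ + L)) :=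
    hz.continuous.fst.continuousOn
  have hdiff : DifferentiableOn ℝ (fun t => (z t).1) (interior (Set.Icc τ (τ + L))) :=
    fun t _ => (hz.hasDerivAt_fst t).differentiableAt.differentiableWithinAt
  have hl : τ ∈ Set.Icc τ (τ + L) := ⟨le_rfl, by linarith⟩
  have hr : τ + L ∈ Set.Icc τ (τ + L) := ⟨by linarith, le_rfl⟩
  constructor
  · have := (convex_Icc τ (τ + L)).mul_sub_le_image_sub_of_le_deriv hcont hdiff
      (C := velocity (r - (C * L + D))) (fun t ht => by
        rw [(hz.hasDerivAt_fst t).deriv]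
        refine strictMono_velocity.monotone ?_
        linarith [(abs_le.1 (hv t (interior_subset ht))).1]) τ hl (τ + L) hr (by linarith)
    rw [h]
    simp only [h0, add_sub_cancel_left] at this
    linarith
  · have := (convex_Icc τ (τ + L)).image_sub_le_mul_sub_of_deriv_le hcont hdiff
      (C := velocity (r + (C * L + D))) (fun t ht => by
        rw [(hz.hasDerivAt_fst t).deriv]
        refine strictMono_velocity.monotone ?_
        linarith [(abs_le.1 (hv t (interior_subset ht))).2]) τ hl (τ + L) hr (by linarith)
    rw [h]
    simp only [h0, add_sub_cancel_left] at this
    linarith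

theorem tendstoUniformly_of_mem_Icc {l : Filter ℝ} {f : ℝ → ℝ → ℝ} {a b : ℝ → ℝ} {c : ℝ}
    (h : ∀ r θ, f r θ ∈ Set.Icc (a r) (b r)) (ha : Tendsto a l (𝓝 c)) (hb : Tendsto b l (𝓝 c)) :
    TendstoUniformly f (fun _ => c) l := by
  rw [Metric.tendstoUniformly_iff]
  intro ε hε
  filter_upwards [ha (Metric.ball_mem_nhds c hε), hb (Metric.ball_mem_nhds c hε)] with r h1 h2 θ
  have h1 : |a r - c| < ε := h1
  have h2 : |b r - c| < ε := h2
  rw [abs_lt] at h1 h2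
  rw [dist_comm, Real.dist_eq, abs_lt]
  have := h r θ
  constructor <;> linarith [this.1, this.2]

theorem WellPosed.tendstoUniformly_timeMap_atTop (hw : WellPosed F g) (hF : Continuous F) {C : ℝ}
    (hC : ∀ x, |g x| ≤ C) (τ : ℝ) {L : ℝ} (hL : 0 ≤ L) :
    TendstoUniformly (fun r θ : ℝ => (timeMap F g L τ (θ, r)).1 - θ) (fun _ => L) atTop := by
  obtain ⟨B, hB⟩ := hw.exists_timeMap_fst_sub_mem hF hC τ hL
  refine tendstoUniformly_of_mem_Icc (fun r θ => hB θ r) ?_ ?_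
  · simpa [← sub_eq_add_neg] using (tendsto_velocity_atTop.comp (tendsto_atTop_add_const_right _ (-B)
      tendsto_id)).const_mul L
  · simpa using (tendsto_velocity_atTop.comp (tendsto_atTop_add_const_right _ B
      tendsto_id)).const_mul L

theorem WellPosed.tendstoUniformly_timeMap_atBot (hw : WellPosed F g) (hF : Continuous F) {C : ℝ}
    (hC : ∀ x, |g x| ≤ C) (τ : ℝ) {L : ℝ} (hL : 0 ≤ L) :
    TendstoUniformly (fun r θ : ℝ => (timeMap F g L τ (θ, r)).1 - θ) (fun _ => -L) atBot := by
  obtain ⟨B, hB⟩ := hw.exists_timeMap_fst_sub_mem hF hC τ hL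
  refine tendstoUniformly_of_mem_Icc (fun r θ => hB θ r) ?_ ?_
  · simpa [← sub_eq_add_neg] using (tendsto_velocity_atBot.comp (tendsto_atBot_add_const_right _ (-B)
      tendsto_id)).const_mul L
  · simpa using (tendsto_velocity_atBot.comp (tendsto_atBot_add_const_right _ B
      tendsto_id)).const_mul L

end Flow

/-! ### Smooth dependence on initial data. -/

/-- The momentum along a position curve `u`: `s ↦ p + L ∫ r in 0..s, g (u r)`. -/
noncomputable def momentumCurve (g : C(ℝ, ℝ)) (L p : ℝ) (u : C(unitInterval, ℝ)) :
    C(unitInterval, ℝ) :=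
  p • 1 + L • volterra (compOp g u)

/-- The defect in the integral equation for the position curve of a solution with given initial
data; `Φ` is the forcing along the curve. -/
noncomputable def pathDefect (g : C(ℝ, ℝ)) (L : ℝ) (Φ : C(unitInterval, ℝ))
    (y : (ℝ × ℝ) × C(unitInterval, ℝ)) : C(unitInterval, ℝ) :=
  y.2 - y.1.1 • 1 - L • volterra (compOp velocity (momentumCurve g L y.1.2 y.2 + Φ))

section PathDefect

variable {g g' : C(ℝ, ℝ)} {L : ℝ} {Φ : C(unitInterval, ℝ)}

theorem contDiff_momentumCurve {n : ℕ} (hg : ContDiff ℝ n g) :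
    ContDiff ℝ n fun y : ℝ × C(unitInterval, ℝ) => momentumCurve g L y.1 y.2 :=
  (contDiff_fst.smul contDiff_const).add
    ((volterra.contDiff.comp ((contDiff_compOp g hg).comp contDiff_snd)).const_smul L)

theorem contDiff_pathDefect {n : ℕ} (hg : ContDiff ℝ n g) : ContDiff ℝ n (pathDefect g L Φ) := by
  refine (contDiff_snd.sub (contDiff_fst.fst.smul contDiff_const)).sub
    ((volterra.contDiff.comp ((contDiff_compOp velocity contDiff_velocity).comp
      (ContDiff.add ?_ contDiff_const))).const_smul L)
  exact (contDiff_momentumCurve hg).comp (contDiff_fst.snd.prodMk contDiff_snd)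

theorem hasFDerivAt_pathDefect_snd (hg : ∀ x, HasDerivAt g (g' x) x) (x : ℝ × ℝ)
    (u : C(unitInterval, ℝ)) :
    HasFDerivAt (fun u => pathDefect g L Φ (x, u))
      (1 - volterra * mulOp (L • compOp velocityDeriv (momentumCurve g L x.2 u + Φ)) *
        (volterra * mulOp (L • compOp g' u))) u := by
  have h1 : HasFDerivAt (fun u => momentumCurve g L x.2 u + Φ)
      (L • (volterra ∘L mulOp (compOp g' u))) u :=
    (((volterra.hasFDerivAt.comp u (hasFDerivAt_compOp hg u)).const_smul L).const_add _).add_const _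
  have h2 := (volterra.hasFDerivAt.comp u
    ((hasFDerivAt_compOp hasDerivAt_velocity (momentumCurve g L x.2 u + Φ)).comp u h1)).const_smul L
  refine (((hasFDerivAt_id u).sub_const (x.1 • (1 : C(unitInterval, ℝ)))).sub h2).congr_fderiv ?_
  ext w : 1
  simp [mul_comm]

/-- The weighted contraction estimate makes zeros unique among all curves, not only nearby ones.
This is what identifies the local implicit function with the given solution map. -/
theorem pathDefect_injective {K : NNReal} (hg : LipschitzWith K g) (x : ℝ × ℝ) :
    Function.Injective fun u => pathDefect g L Φ (x, u) := by
  intro u v huv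
  simp only [pathDefect] at huv
  set a := momentumCurve g L x.2 u + Φ with ha
  set b := momentumCurve g L x.2 v + Φ with hb
  have h1 : u - v = L • volterra (compOp velocity a - compOp velocity b) := by
    rw [map_sub, smul_sub]
    linear_combination (exp := 1) huv
  have h2 : a - b = L • volterra (compOp g u - compOp g v) := by
    rw [map_sub, smul_sub, ha, hb, momentumCurve, momentumCurve]
    abel
  obtain ⟨k, hk, hk1⟩ : ∃ k : ℝ, 0 < k ∧ (|L| * k⁻¹) * ((|L| * k⁻¹) * K) < 1 := by
    -- This k gives |L|(1 + K)/k < 1, which bounds both |L|/k and |L|K/k below 1.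
    refine ⟨|L| * (1 + K) + 1, by positivity, ?_⟩
    have h0 : |L| * (|L| * (1 + K) + 1)⁻¹ * (1 + K) < 1 := by
      rw [mul_right_comm, ← div_eq_mul_inv, div_lt_one (by positivity)]; linarith
    have hK : (0 : ℝ) ≤ K := K.2
    have h3 : |L| * (|L| * (1 + K) + 1)⁻¹ ≤ |L| * (|L| * (1 + K) + 1)⁻¹ * (1 + K) :=
      le_mul_of_one_le_right (by positivity) (by linarith)
    refine mul_lt_one_of_nonneg_of_lt_one_left (by positivity) (h3.trans_lt h0) ?_
    refine le_trans ?_ h0.le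
    gcongr
    linarith
  have hvol : ∀ w, ‖expWeight (-k) * (L • volterra w)‖ ≤ |L| * k⁻¹ * ‖expWeight (-k) * w‖ := by
    intro w
    rw [mul_smul_comm, norm_smul, Real.norm_eq_abs, mul_assoc]
    gcongr
    exact norm_expWeight_neg_mul_volterra_le hk w
  have h3 : ‖expWeight (-k) * (u - v)‖ ≤ |L| * k⁻¹ * (1 * ‖expWeight (-k) * (a - b)‖) := by
    rw [h1]
    refine (hvol _).trans ?_
    gcongr
    exact norm_le_of_pointwise zero_le_one (fun s => by
      simpa [Real.dist_eq, compOp_apply] using lipschitzWith_velocity.dist_le_mul (a s) (b s)) _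
  have h4 : ‖expWeight (-k) * (a - b)‖ ≤ |L| * k⁻¹ * (K * ‖expWeight (-k) * (u - v)‖) := by
    rw [h2]
    refine (hvol _).trans ?_
    gcongr
    exact norm_le_of_pointwise K.2 (fun s => by
      simpa [Real.dist_eq, compOp_apply] using hg.dist_le_mul (u s) (v s)) _
  have h5 : ‖expWeight (-k) * (u - v)‖ ≤
      (|L| * k⁻¹) * ((|L| * k⁻¹) * K) * ‖expWeight (-k) * (u - v)‖ := by
    refine (h3.trans (mul_le_mul_of_nonneg_left (mul_le_mul_of_nonneg_left h4 zero_le_one)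
      (by positivity))).trans_eq ?_
    ring
  have h6 : ‖expWeight (-k) * (u - v)‖ = 0 := by
    by_contra hne
    have hpos : 0 < ‖expWeight (-k) * (u - v)‖ := lt_of_le_of_ne (norm_nonneg _) (Ne.symm hne)
    nlinarith
  have h7 : expWeight k * (expWeight (-k) * (u - v)) = 0 := by rw [norm_eq_zero.1 h6, mul_zero]
  rw [← mul_assoc, mul_comm (expWeight k), expWeight_neg_mul, one_mul] at h7
  exact sub_eq_zero.1 h7

/-- A solution map of the integral equation is as smooth as the force. -/
theorem contDiff_of_pathDefect_eq_zero {n : ℕ} (hn : n ≠ 0) (hg : ContDiff ℝ n g) {K : NNReal}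
    (hK : LipschitzWith K g) {S : ℝ × ℝ → C(unitInterval, ℝ)}
    (hS : ∀ x, pathDefect g L Φ (x, S x) = 0) : ContDiff ℝ n S := by
  have hn' : (n : WithTop ℕ∞) ≠ 0 := by exact_mod_cast hn
  have hn1 : (1 : WithTop ℕ∞) ≤ n := by exact_mod_cast Nat.one_le_iff_ne_zero.2 hn
  have hgd : Differentiable ℝ g := hg.differentiable hn'
  let g' : C(ℝ, ℝ) := ⟨deriv g, hg.continuous_deriv hn1⟩
  have hf : ContDiff ℝ n (pathDefect g L Φ) := contDiff_pathDefect hg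
  rw [contDiff_iff_contDiffAt]
  intro x
  have hfd := (hf.differentiable hn' (x, S x)).hasFDerivAt
  have hcomp : fderiv ℝ (pathDefect g L Φ) (x, S x) ∘L .inr ℝ (ℝ × ℝ) C(unitInterval, ℝ) = _ :=
    (hfd.comp (S x) (hasFDerivAt_prodMk_right x (S x))).unique
      (hasFDerivAt_pathDefect_snd (g' := g') (fun y => (hgd y).hasDerivAt) x (S x))
  have hinv : (fderiv ℝ (pathDefect g L Φ) (x, S x) ∘L
      .inr ℝ (ℝ × ℝ) C(unitInterval, ℝ)).IsInvertible := by
    rw [hcomp]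
    obtain ⟨U, hU⟩ := isUnit_one_sub_volterra
      (L • compOp velocityDeriv (momentumCurve g L x.2 (S x) + Φ)) (L • compOp g' (S x))
    exact ⟨ContinuousLinearEquiv.unitsEquiv ℝ _ U, by rw [← hU]; rfl⟩
  refine (hf.contDiffAt.contDiffAt_implicitFunction hn' hinv).congr_of_eventuallyEq ?_
  filter_upwards [hf.contDiffAt.eventually_apply_implicitFunction hn' hinv] with y hy
  refine pathDefect_injective (L := L) (Φ := Φ) hK y ?_
  change pathDefect g L Φ _ = pathDefect g L Φ _
  rw [hy, hS, hS]

end PathDefect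

/-- The solutions over a time step, as curves depending smoothly on the initial data. -/
theorem WellPosed.exists_smooth_curves {F : ℝ → ℝ} {g : C(ℝ, ℝ)} (hw : WellPosed F g)
    (hF : Continuous F) {n : ℕ} (hn : n ≠ 0) (hg : ContDiff ℝ n g) {K : NNReal}
    (hK : LipschitzWith K g) (L τ : ℝ) :
    ∃ (Φ : C(unitInterval, ℝ)) (S P : ℝ × ℝ → C(unitInterval, ℝ)),
      (∀ x (s : unitInterval), timeMap F g (L * s) τ x = (S x s, P x s)) ∧
      (∀ x, S x = x.1 • 1 + L • volterra (compOp velocity (P x + Φ))) ∧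
      (∀ x, P x = x.2 • 1 + L • volterra (compOp g (S x))) ∧
      ContDiff ℝ n S ∧ ContDiff ℝ n P := by
  choose z hz hz0 hzt using hw.exists_isSolution_timeMap τ
  have hzc : ∀ x, Continuous (z x) := fun x => (hz x).continuous
  let Φ : C(unitInterval, ℝ) := ⟨fun s => F (τ + L * s), by fun_prop⟩
  let S : ℝ × ℝ → C(unitInterval, ℝ) := fun x => ⟨fun s => (z x (τ + L * s)).1, by fun_prop⟩
  let P : ℝ × ℝ → C(unitInterval, ℝ) := fun x => ⟨fun s => (z x (τ + L * s)).2, by fun_prop⟩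
  have key : ∀ (w w' : ℝ → ℝ) (c : C(unitInterval, ℝ)), Continuous w' →
      (∀ t, HasDerivAt w (w' t) t) → (∀ s : unitInterval, c s = w' (τ + L * s)) →
      ∀ s : unitInterval, w (τ + L * s) = w τ + L * volterra c s := by
    intro w w' c hc hw hcs s
    have h1 : ∀ t, HasDerivAt (fun t => w (τ + L * t)) (L * w' (τ + L * t)) t := fun t => by
      have h0 : HasDerivAt (fun t => τ + L * t) L t := by
        simpa using ((hasDerivAt_id t).const_mul L).const_add τ
      exact ((hw (τ + L * t)).comp t h0).congr_deriv (mul_comm _ _)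
    have h2 := intervalIntegral.integral_eq_sub_of_hasDerivAt (a := 0) (b := s)
      (fun t _ => h1 t) ((by fun_prop : Continuous fun t => L * w' (τ + L * t)).intervalIntegrable
        _ _)
    have h3 : volterra c s = ∫ t in (0 : ℝ)..s, w' (τ + L * t) := by
      rw [volterra_apply]
      refine intervalIntegral.integral_congr fun t ht => ?_
      rw [Set.uIcc_of_le s.2.1] at ht
      rw [Set.projIcc_of_mem _ ⟨ht.1, ht.2.trans s.2.2⟩, hcs]
    rw [h3, ← intervalIntegral.integral_const_mul, h2]
    simp
  have hS : ∀ x, S x = x.1 • 1 + L • volterra (compOp velocity (P x + Φ)) := fun x => by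
    ext s
    have := key (fun t => (z x t).1) (fun t => velocity ((z x t).2 + F t))
      (compOp velocity (P x + Φ)) (by have := hzc x; fun_prop) (hz x).hasDerivAt_fst
      (fun s => rfl) s
    simpa [S, hz0] using this
  have hP : ∀ x, P x = x.2 • 1 + L • volterra (compOp g (S x)) := fun x => by
    ext s
    have := key (fun t => (z x t).2) (fun t => g (z x t).1)
      (compOp g (S x)) (by have := hzc x; fun_prop) (hz x).hasDerivAt_snd
      (fun s => rfl) s
    simpa [P, hz0] using this
  have hSc : ContDiff ℝ n S := by
    refine contDiff_of_pathDefect_eq_zero (L := L) (Φ := Φ) hn hg hK fun x => ?_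
    rw [pathDefect, momentumCurve, ← hP, sub_sub, ← hS, sub_self]
  refine ⟨Φ, S, P, fun x s => hzt x _, hS, hP, hSc, ?_⟩
  rw [show P = fun x => momentumCurve g L x.2 (S x) from funext hP]
  exact (contDiff_momentumCurve hg).comp (contDiff_snd.prodMk hSc)

/-- On a finite-dimensional domain pointwise and norm continuity agree; currying reduces the
multilinear case to the linear one. -/
theorem continuous_continuousMultilinearMap_of_apply {Z E G : Type*} [TopologicalSpace Z]
    [NormedAddCommGroup E] [NormedSpace ℝ E] [FiniteDimensional ℝ E]
    [NormedAddCommGroup G] [NormedSpace ℝ G] {k : ℕ}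
    {f : Z → ContinuousMultilinearMap ℝ (fun _ : Fin k => E) G}
    (h : ∀ v, Continuous fun z => f z v) : Continuous f := by
  induction k with
  | zero =>
    rw [← (continuousMultilinearCurryFin0 ℝ E G).comp_continuous_iff]
    exact h 0
  | succ k ih =>
    rw [← (continuousMultilinearCurryLeftEquiv ℝ (fun _ : Fin (k + 1) => E) G).comp_continuous_iff]
    refine continuous_clm_apply.2 fun e => ih fun v => ?_
    exact h (Fin.cons e v)

/-- Evaluation at `s` is linear, so it commutes with derivatives in `x`. It is not norm continuous
in `s`, which is why continuity is checked on fixed vectors, where joint continuity of evaluation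
suffices. -/
theorem continuous_iteratedFDeriv_eval {E : Type*} [NormedAddCommGroup E] [NormedSpace ℝ E]
    [FiniteDimensional ℝ E] {n k : ℕ} (hk : k ≤ n) {S P : E → C(unitInterval, ℝ)}
    (hS : ContDiff ℝ n S) (hP : ContDiff ℝ n P) :
    Continuous fun p : unitInterval × E =>
      iteratedFDeriv ℝ k (fun x => (S x p.1, P x p.1)) p.2 := by
  have hk' : (k : WithTop ℕ∞) ≤ n := by exact_mod_cast hk
  let ev : unitInterval → C(unitInterval, ℝ) × C(unitInterval, ℝ) →L[ℝ] ℝ × ℝ := fun s =>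
    (ContinuousMap.evalCLM ℝ s).prodMap (ContinuousMap.evalCLM ℝ s)
  have hR : ContDiff ℝ n fun x => (S x, P x) := hS.prodMk hP
  have heq : ∀ p : unitInterval × E, iteratedFDeriv ℝ k (fun x => (S x p.1, P x p.1)) p.2 =
      (ev p.1).compContinuousMultilinearMap (iteratedFDeriv ℝ k (fun x => (S x, P x)) p.2) :=
    fun p => (ev p.1).iteratedFDeriv_comp_left hR.contDiffAt hk'
  simp only [heq]
  refine continuous_continuousMultilinearMap_of_apply fun v => ?_
  have hc : Continuous fun p : unitInterval × E =>
      iteratedFDeriv ℝ k (fun x => (S x, P x)) p.2 v := by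
    have := (hR.continuous_iteratedFDeriv hk').comp (continuous_snd (X := unitInterval))
    exact (continuous_eval_const v).comp this
  exact (hc.fst.eval continuous_fst).prodMk (hc.snd.eval continuous_fst)

/-! ### Diffeomorphism and isotopy. -/

section Flow

variable {F : ℝ → ℝ} {g : C(ℝ, ℝ)}

theorem WellPosed.contDiff_timeMap (hw : WellPosed F g) (hF : Continuous F) {n : ℕ} (hn : n ≠ 0)
    (hg : ContDiff ℝ n g) {K : NNReal} (hK : LipschitzWith K g) (L τ : ℝ) :
    ContDiff ℝ n (timeMap F g L τ) := by
  obtain ⟨Φ, S, P, hSP, -, -, hS, hP⟩ := hw.exists_smooth_curves hF hn hg hK L τ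
  have h : timeMap F g L τ = fun x => (ContinuousMap.evalCLM ℝ (1 : unitInterval) (S x),
      ContinuousMap.evalCLM ℝ (1 : unitInterval) (P x)) := by
    funext x
    simpa using hSP x 1
  rw [h]
  exact ((ContinuousLinearMap.contDiff _).comp hS).prodMk ((ContinuousLinearMap.contDiff _).comp hP)

theorem WellPosed.isCylinderDiffeo_timeMap (hw : WellPosed F g) (hF : Continuous F)
    (hg : ContDiff ℝ 2 g) {K : NNReal} (hK : LipschitzWith K g) (hper : ∀ x, g (x + 1) = g x)
    (L τ : ℝ) : IsCylinderDiffeo (timeMap F g L τ) where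
  contDiff := hw.contDiff_timeMap hF (n := 2) two_ne_zero hg hK L τ
  exists_inverse := ⟨timeMap F g (-L) (τ + L), hw.timeMap_neg_timeMap τ L,
    hw.timeMap_timeMap_neg τ L, hw.contDiff_timeMap hF (n := 2) two_ne_zero hg hK (-L) (τ + L)⟩
  periodic := hw.timeMap_periodic hper τ L

theorem WellPosed.isotopicToId_timeMap (hw : WellPosed F g) (hF : Continuous F)
    (hg : ContDiff ℝ 2 g) {K : NNReal} (hK : LipschitzWith K g) (hper : ∀ x, g (x + 1) = g x)
    (L τ : ℝ) : IsotopicToId (timeMap F g L τ) := by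
  obtain ⟨Φ, S, P, hSP, -, -, hS, hP⟩ :=
    hw.exists_smooth_curves hF (n := 2) two_ne_zero hg hK L τ
  refine ⟨fun s => timeMap F g (L * s) τ, fun s => hw.isCylinderDiffeo_timeMap hF hg hK hper _ τ,
    ?_, ?_, fun k hk => ?_⟩
  · funext x
    simpa using hw.timeMap_zero τ x
  · simp
  · have h : ∀ s : unitInterval, timeMap F g (L * s) τ = fun x => (S x s, P x s) :=
      fun s => funext fun x => hSP x s
    simp only [h]
    exact continuous_iteratedFDeriv_eval hk hS hP

end Flow

/-! ### Sturm comparison. -/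

/-- Sturm comparison for `A' = p B`, `B' = q A` on `[0, 1]`: before the first conjugate point of
the comparison equation, `A` stays positive. -/
theorem pos_of_sturm_comparison {A B p q : ℝ → ℝ} {L M : ℝ}
    (hA : ∀ t ∈ Set.Icc (0 : ℝ) 1, HasDerivAt A (p t * B t) t)
    (hB : ∀ t ∈ Set.Icc (0 : ℝ) 1, HasDerivAt B (q t * A t) t) (hA0 : A 0 = 0) (hB0 : B 0 = 1)
    (hp : ∀ t ∈ Set.Icc (0 : ℝ) 1, 0 < p t ∧ p t ≤ L)
    (hq : ∀ t ∈ Set.Icc (0 : ℝ) 1, -(L * M) ≤ q t) (hLM : L * Real.sqrt M < Real.pi) :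
    0 < A 1 := by
  have h0 : (0 : ℝ) ∈ Set.Icc (0 : ℝ) 1 := ⟨le_rfl, zero_le_one⟩
  have hL : 0 < L := (hp 0 h0).1.trans_le (hp 0 h0).2
  obtain ⟨ω, hω1, hω2⟩ : ∃ ω, Real.sqrt M < ω ∧ ω < Real.pi / L :=
    exists_between (by rwa [lt_div_iff₀ hL, mul_comm])
  have hω : 0 < ω := (Real.sqrt_nonneg M).trans_lt hω1
  have hM : M < ω ^ 2 := (Real.sqrt_lt' hω).1 hω1
  rw [lt_div_iff₀ hL] at hω2
  have hpos : ∀ᶠ t in 𝓝[>] (0 : ℝ), 0 < A t := by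
    have h := hasDerivAt_iff_tendsto_slope.1 (hA 0 h0)
    have h' := (h.mono_left (nhdsWithin_mono 0 fun t (ht : 0 < t) => ht.ne')).eventually
      (lt_mem_nhds (show 0 < p 0 * B 0 by rw [hB0, mul_one]; exact (hp 0 h0).1))
    filter_upwards [h', self_mem_nhdsWithin] with t ht ht0
    have ht0 : 0 < t := ht0
    rw [slope_def_field, hA0, sub_zero, sub_zero] at ht
    exact (div_pos_iff_of_pos_right ht0).1 ht
  have hne : ∀ t₁ ∈ Set.Ioc (0 : ℝ) 1, A t₁ ≠ 0 := by
    intro t₁ ht₁ hzero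
    -- This shift keeps ωLt + ε inside (0, π) on [0, 1], so the comparison solution sin(ωLt + ε) has
    -- no zero, not even at t = 0. For a' = Lb, b' = -Lω²a, the quotient κ = b/a solves the Riccati
    -- equation below.
    let ε := (Real.pi - ω * L) / 2
    have hε : 0 < ε := by simp only [ε]; linarith
    let κ : ℝ → ℝ := fun t => ω * (Real.cos (ω * L * t + ε) / Real.sin (ω * L * t + ε))
    have hsub : Set.Icc 0 t₁ ⊆ Set.Icc 0 1 := Set.Icc_subset_Icc_right ht₁.2
    have hκ : ∀ t ∈ Set.Icc (0 : ℝ) 1, HasDerivAt κ (-(L * (ω ^ 2 + κ t ^ 2))) t := by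
      intro t ht
      have hin : HasDerivAt (fun t => ω * L * t + ε) (ω * L) t := by
        simpa using ((hasDerivAt_id t).const_mul (ω * L)).add_const ε
      have hs : 0 < Real.sin (ω * L * t + ε) := by
        have h1 : 0 ≤ ω * L * t := mul_nonneg (by positivity) ht.1
        have h2 : ω * L * t ≤ ω * L := mul_le_of_le_one_right (by positivity) ht.2
        refine Real.sin_pos_of_pos_of_lt_pi (by linarith) ?_
        simp only [ε]; linarith
      refine (((hin.cos.div hin.sin hs.ne')).const_mul ω).congr_deriv ?_
      simp only [κ]
      field_simp
      ring
    -- Picone's identity: Y' = D is a sum of nonnegative terms, and Y vanishes wherever A does. Two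
    -- zeros of A would force D = 0 between them, although D > 0 where A ≠ 0; the strict inequality
    -- M < ω² is used here.
    let Y : ℝ → ℝ := fun t => A t * B t - A t ^ 2 * κ t
    let D : ℝ → ℝ := fun t => p t * (B t - A t * κ t) ^ 2 + (L - p t) * (A t * κ t) ^ 2 +
      (q t + L * ω ^ 2) * A t ^ 2
    have hY : ∀ t ∈ Set.Icc (0 : ℝ) 1, HasDerivAt Y (D t) t := fun t ht =>
      (((hA t ht).mul (hB t ht)).sub (((hA t ht).pow 2).mul (hκ t ht))).congr_deriv (by
        simp only [D, Pi.pow_apply]; push_cast; ring)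
    have hDle : ∀ t ∈ Set.Icc (0 : ℝ) 1, L * (ω ^ 2 - M) * A t ^ 2 ≤ D t := fun t ht => by
      have h1 : 0 ≤ p t * (B t - A t * κ t) ^ 2 := mul_nonneg (hp t ht).1.le (sq_nonneg _)
      have h2 : 0 ≤ (L - p t) * (A t * κ t) ^ 2 :=
        mul_nonneg (sub_nonneg.2 (hp t ht).2) (sq_nonneg _)
      have h3 : L * (ω ^ 2 - M) * A t ^ 2 ≤ (q t + L * ω ^ 2) * A t ^ 2 := by
        refine mul_le_mul_of_nonneg_right ?_ (sq_nonneg _)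
        linarith [hq t ht]
      simp only [D]; linarith
    have hLω : 0 < L * (ω ^ 2 - M) := mul_pos hL (sub_pos.2 hM)
    have hmono : MonotoneOn Y (Set.Icc 0 t₁) :=
      monotoneOn_of_deriv_nonneg (convex_Icc _ _)
        (fun t ht => (hY t (hsub ht)).continuousAt.continuousWithinAt)
        (fun t ht => (hY t (hsub (interior_subset ht))).differentiableAt.differentiableWithinAt)
        (fun t ht => by
          rw [(hY t (hsub (interior_subset ht))).deriv]
          exact (mul_nonneg hLω.le (sq_nonneg _)).trans (hDle t (hsub (interior_subset ht))))
    have hYzero : ∀ t ∈ Set.Icc 0 t₁, Y t = 0 := fun t ht => by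
      have h1 := hmono ⟨le_rfl, ht₁.1.le⟩ ht ht.1
      have h2 := hmono ht ⟨ht₁.1.le, le_rfl⟩ ht.2
      have h3 : Y 0 = 0 := by simp [Y, hA0]
      have h4 : Y t₁ = 0 := by simp [Y, hzero]
      linarith
    obtain ⟨t, htA, ht⟩ := (hpos.and (Ioo_mem_nhdsGT ht₁.1)).exists
    have htI : t ∈ Set.Icc 0 t₁ := Set.Ioo_subset_Icc_self ht
    have hD0 : D t = 0 := (hY t (hsub htI)).unique <|
      (hasDerivAt_const t (0 : ℝ)).congr_of_eventuallyEq <| by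
        filter_upwards [Ioo_mem_nhds ht.1 ht.2] with s hs using hYzero s (Set.Ioo_subset_Icc_self hs)
    have := hDle t (hsub htI)
    rw [hD0] at this
    exact absurd this (not_le.2 (mul_pos hLω (pow_pos htA 2)))
  by_contra hA1
  obtain ⟨t, ⟨ht, htA⟩⟩ := (hpos.and (Ioo_mem_nhdsGT zero_lt_one)).exists
  have hcont : ContinuousOn A (Set.Icc t 1) := fun s hs =>
    (hA s ⟨htA.1.le.trans hs.1, hs.2⟩).continuousAt.continuousWithinAt
  obtain ⟨s, hs, hs0⟩ := intermediate_value_Icc' htA.2.le hcont ⟨not_lt.1 hA1, ht.le⟩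
  exact hne s ⟨htA.1.trans_le hs.1, hs.2⟩ hs0

/-! ### Variational equations: twist and action. -/

/-- Integration by parts for curves given as integrals; it produces the boundary terms R dΘ - r dθ.
-/
theorem volterra_mul_add_mul {u u' w w' : C(unitInterval, ℝ)} {c c' : ℝ}
    (h : ∀ s, u s = c + volterra w s) (h' : ∀ s, u' s = c' + volterra w' s) :
    volterra (w * u' + u * w') 1 = u 1 * u' 1 - c * c' := by
  obtain ⟨U, hU, hU0, hUs⟩ := exists_hasDerivAt_of_eq_volterra h
  obtain ⟨U', hU', hU0', hUs'⟩ := exists_hasDerivAt_of_eq_volterra h'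
  have hcU : Continuous U := continuous_iff_continuousAt.2 fun t => (hU t).continuousAt
  have hcU' : Continuous U' := continuous_iff_continuousAt.2 fun t => (hU' t).continuousAt
  have hw : ∀ w : C(unitInterval, ℝ), Continuous fun t : ℝ => w (Set.projIcc 0 1 zero_le_one t) :=
    fun w => w.continuous.comp continuous_projIcc
  have h1 := intervalIntegral.integral_eq_sub_of_hasDerivAt (a := 0) (b := 1)
    (fun t _ => (hU t).mul (hU' t))
    ((((hw w).mul hcU').add (hcU.mul (hw w'))).intervalIntegrable _ _)
  have h2 : volterra (w * u' + u * w') 1 = ∫ t in (0 : ℝ)..1,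
      w (Set.projIcc 0 1 zero_le_one t) * U' t + U t * w' (Set.projIcc 0 1 zero_le_one t) := by
    rw [volterra_apply, Set.Icc.coe_one]
    refine intervalIntegral.integral_congr fun t ht => ?_
    rw [Set.uIcc_of_le zero_le_one] at ht
    have e1 := hUs ⟨t, ht⟩
    have e2 := hUs' ⟨t, ht⟩
    simp only [Set.projIcc_of_mem _ ht, ContinuousMap.add_apply, ContinuousMap.mul_apply]
    rw [← e1, ← e2]
  have e1 := hUs 1
  have e2 := hUs' 1
  rw [Set.Icc.coe_one] at e1 e2
  rw [h2, h1, Pi.mul_apply, Pi.mul_apply, e1, e2, hU0, hU0']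

/-- The kinetic energy `u ↦ √(1 + u²)`. -/
noncomputable def kineticEnergy : C(ℝ, ℝ) := ⟨fun u => Real.sqrt (1 + u ^ 2), by fun_prop⟩

theorem hasDerivAt_kineticEnergy (u : ℝ) : HasDerivAt kineticEnergy (velocity u) u :=
  hasDerivAt_sqrt_one_add_sq u

section Variation

variable {g g' : C(ℝ, ℝ)} {L : ℝ} {Φ : C(unitInterval, ℝ)} {S P : ℝ × ℝ → C(unitInterval, ℝ)}
  {x : ℝ × ℝ} {S' P' : ℝ × ℝ →L[ℝ] C(unitInterval, ℝ)}

theorem variation_position (hS : ∀ x, S x = x.1 • 1 + L • volterra (compOp velocity (P x + Φ)))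
    (hS' : HasFDerivAt S S' x) (hP' : HasFDerivAt P P' x) (h : ℝ × ℝ) (s : unitInterval) :
    S' h s = h.1 + volterra (L • (compOp velocityDeriv (P x + Φ) * P' h)) s := by
  have h1 := (hasFDerivAt_fst (𝕜 := ℝ) (p := x)).smul_const (1 : C(unitInterval, ℝ))
  have h2 := (volterra.hasFDerivAt.comp x ((hasFDerivAt_compOp hasDerivAt_velocity (P x + Φ)).comp x
    (hP'.add_const Φ))).const_smul L
  rw [show S = _ from funext hS] at hS'
  rw [hS'.unique (h1.add h2)]
  simp

theorem variation_momentum (hg : ∀ x, HasDerivAt g (g' x) x)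
    (hP : ∀ x, P x = x.2 • 1 + L • volterra (compOp g (S x)))
    (hS' : HasFDerivAt S S' x) (hP' : HasFDerivAt P P' x) (h : ℝ × ℝ) (s : unitInterval) :
    P' h s = h.2 + volterra (L • (compOp g' (S x) * S' h)) s := by
  have h1 := (hasFDerivAt_snd (𝕜 := ℝ) (p := x)).smul_const (1 : C(unitInterval, ℝ))
  have h2 := (volterra.hasFDerivAt.comp x ((hasFDerivAt_compOp hg (S x)).comp x hS')).const_smul L
  rw [show P = _ from funext hP] at hP'
  rw [hP'.unique (h1.add h2)]
  simp

theorem twist_of_variation (hg : ∀ x, HasDerivAt g (g' x) x) {M : ℝ} (hM : ∀ x, -M ≤ g' x)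
    (hL : 0 < L) (hLM : L * Real.sqrt M < Real.pi)
    (hS : ∀ x, S x = x.1 • 1 + L • volterra (compOp velocity (P x + Φ)))
    (hP : ∀ x, P x = x.2 • 1 + L • volterra (compOp g (S x)))
    (hS' : HasFDerivAt S S' x) (hP' : HasFDerivAt P P' x) : 0 < S' (0, 1) 1 := by
  obtain ⟨A, hA, hA0, hAs⟩ := exists_hasDerivAt_of_eq_volterra
    (variation_position hS hS' hP' (0, 1))
  obtain ⟨B, hB, hB0, hBs⟩ := exists_hasDerivAt_of_eq_volterra
    (variation_momentum hg hP hS' hP' (0, 1))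
  have hA1 := hAs 1
  rw [Set.Icc.coe_one] at hA1
  rw [← hA1]
  refine pos_of_sturm_comparison
    (p := fun t => L * velocityDeriv ((P x + Φ) (Set.projIcc 0 1 zero_le_one t)))
    (q := fun t => L * g' (S x (Set.projIcc 0 1 zero_le_one t)))
    (fun t ht => ?_) (fun t ht => ?_) hA0 hB0 (fun t ht => ⟨?_, ?_⟩) (fun t ht => ?_) hLM
  · refine (hA t).congr_deriv ?_
    have := hBs ⟨t, ht⟩
    simp only at this
    rw [Set.projIcc_of_mem _ ht, this]
    simp [compOp_apply, mul_assoc]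
  · refine (hB t).congr_deriv ?_
    have := hAs ⟨t, ht⟩
    simp only at this
    rw [Set.projIcc_of_mem _ ht, this]
    simp [compOp_apply, mul_assoc]
  · exact mul_pos hL (velocityDeriv_pos _)
  · exact mul_le_of_le_one_right hL.le (velocityDeriv_le_one _)
  · rw [← mul_neg]
    exact mul_le_mul_of_nonneg_left (hM _) hL.le

/-- The action of a solution, as a function of its position and momentum curves. -/
noncomputable def actionAlong (G : C(ℝ, ℝ)) (L : ℝ) (Φ u p : C(unitInterval, ℝ)) : ℝ :=
  L * volterra (p * compOp velocity (p + Φ) - compOp kineticEnergy (p + Φ) + compOp G u) 1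

/-- First variation of the action: the two velocity·dP terms cancel, and by the equations of motion
the remaining integrand is the time derivative of P·dQ. -/
theorem hasFDerivAt_actionAlong {G : C(ℝ, ℝ)} (hG : ∀ x, HasDerivAt G (g x) x)
    (hS : ∀ x, S x = x.1 • 1 + L • volterra (compOp velocity (P x + Φ)))
    (hP : ∀ x, P x = x.2 • 1 + L • volterra (compOp g (S x)))
    (hS' : HasFDerivAt S S' x) (hP' : HasFDerivAt P P' x) :
    HasFDerivAt (fun x => actionAlong G L Φ (S x) (P x))
      (P x 1 • (ContinuousMap.evalCLM ℝ (1 : unitInterval) ∘L S') -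
        x.2 • ContinuousLinearMap.fst ℝ ℝ ℝ) x := by
  have hPΦ := hP'.add_const Φ
  have h1 := hP'.mul ((hasFDerivAt_compOp hasDerivAt_velocity (P x + Φ)).comp x hPΦ)
  have h2 := (hasFDerivAt_compOp hasDerivAt_kineticEnergy (P x + Φ)).comp x hPΦ
  have h3 := (hasFDerivAt_compOp hG (S x)).comp x hS'
  have h4 := ((ContinuousMap.evalCLM ℝ (1 : unitInterval) ∘L volterra).hasFDerivAt.comp x
    ((h1.sub h2).add h3)).const_mul L
  refine h4.congr_fderiv ?_
  refine ContinuousLinearMap.ext fun h => ?_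
  have hPv : ∀ s, P x s = x.2 + volterra (L • compOp g (S x)) s := fun s => by
    conv_lhs => rw [hP x]
    simp
  have key := volterra_mul_add_mul hPv (variation_position hS hS' hP' h)
  have e : (L • compOp g (S x)) * S' h + P x * (L • (compOp velocityDeriv (P x + Φ) * P' h)) =
      L • (P x * (compOp velocityDeriv (P x + Φ) * P' h) + compOp velocity (P x + Φ) * P' h -
        compOp velocity (P x + Φ) * P' h + compOp g (S x) * S' h) := by
    ext s
    simp
    ring
  rw [e, map_smul] at key
  simpa using key

end Variation

/-! ### Exactness and twist of the time map. -/

section Flow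

variable {F : ℝ → ℝ} {g : C(ℝ, ℝ)}

theorem WellPosed.isExactSymplectic_timeMap (hw : WellPosed F g) (hF : Continuous F)
    (hg : ContDiff ℝ 1 g) {K : NNReal} (hK : LipschitzWith K g) (hper : ∀ x, g (x + 1) = g x)
    (hmean : ∫ x in (0 : ℝ)..1, g x = 0) (L τ : ℝ) : IsExactSymplectic (timeMap F g L τ) := by
  have hg1 : ContDiff ℝ (1 : ℕ) g := by exact_mod_cast hg
  obtain ⟨Φ, S, P, hSP, hS, hP, hSd, hPd⟩ := hw.exists_smooth_curves hF one_ne_zero hg1 hK L τ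
  have hGd : ∀ x, HasDerivAt (fun x => ∫ y in (0 : ℝ)..x, g y) (g x) x := fun x =>
    intervalIntegral.integral_hasDerivAt_right (g.continuous.intervalIntegrable _ _)
      g.continuous.stronglyMeasurable.stronglyMeasurableAtFilter g.continuous.continuousAt
  let G : C(ℝ, ℝ) := ⟨fun x => ∫ y in (0 : ℝ)..x, g y,
    continuous_iff_continuousAt.2 fun x => (hGd x).continuousAt⟩
  have hGper : ∀ x, G (x + 1) = G x := fun x => by
    have h1 : ∫ y in x..x + 1, g y = 0 := by
      rw [Function.Periodic.intervalIntegral_add_eq (f := g) hper x 0, zero_add, hmean]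
    have h2 := intervalIntegral.integral_add_adjacent_intervals (μ := MeasureTheory.volume)
      (g.continuous.intervalIntegrable 0 x) (g.continuous.intervalIntegrable x (x + 1))
    rw [h1, add_zero] at h2
    exact h2.symm
  have hcurve : ∀ θ r (s : unitInterval), S (θ + 1, r) s = S (θ, r) s + 1 ∧
      P (θ + 1, r) s = P (θ, r) s := fun θ r s => by
    have := hw.timeMap_periodic hper τ (L * s) θ r
    rw [hSP, hSP, Prod.ext_iff] at this
    simpa using this
  refine ⟨fun x => actionAlong G L Φ (S x) (P x), fun θ r => ?_, fun x => ?_⟩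
  · have e1 : P (θ + 1, r) = P (θ, r) := ContinuousMap.ext fun s => (hcurve θ r s).2
    have e2 : compOp G (S (θ + 1, r)) = compOp G (S (θ, r)) := ContinuousMap.ext fun s => by
      rw [compOp_apply, compOp_apply, (hcurve θ r s).1, hGper]
    simp only [actionAlong, e1, e2]
  · have hS' := (hSd.differentiable (by simp) x).hasFDerivAt
    have hP' := (hPd.differentiable (by simp) x).hasFDerivAt
    have h1 : (fun y => (timeMap F g L τ y).1) =
        ContinuousMap.evalCLM ℝ (1 : unitInterval) ∘ S := by
      funext y
      simpa using congrArg Prod.fst (hSP y 1)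
    have h2 : (timeMap F g L τ x).2 = P x 1 := by simpa using congrArg Prod.snd (hSP x 1)
    rw [h1, h2, ((ContinuousMap.evalCLM ℝ (1 : unitInterval)).hasFDerivAt.comp x hS').fderiv]
    exact hasFDerivAt_actionAlong hGd hS hP hS' hP'

theorem WellPosed.isTwist_timeMap (hw : WellPosed F g) (hF : Continuous F)
    (hg : ContDiff ℝ 1 g) {K : NNReal} (hK : LipschitzWith K g) {M : ℝ}
    (hM : ∀ x, |deriv g x| ≤ M) {L : ℝ} (hL : 0 < L) (hLM : L * Real.sqrt M < Real.pi) (τ : ℝ) :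
    IsTwist (timeMap F g L τ) := by
  intro θ r
  have hg1 : ContDiff ℝ (1 : ℕ) g := by exact_mod_cast hg
  obtain ⟨Φ, S, P, hSP, hS, hP, hSd, hPd⟩ := hw.exists_smooth_curves hF one_ne_zero hg1 hK L τ
  have hS' := (hSd.differentiable (by simp) (θ, r)).hasFDerivAt
  have hP' := (hPd.differentiable (by simp) (θ, r)).hasFDerivAt
  let g' : C(ℝ, ℝ) := ⟨deriv g, hg.continuous_deriv le_rfl⟩
  have h1 : (fun s => (timeMap F g L τ (θ, s)).1) =
      fun s => ContinuousMap.evalCLM ℝ (1 : unitInterval) (S (θ, s)) := by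
    funext s
    simpa using congrArg Prod.fst (hSP (θ, s) 1)
  have h2 : HasDerivAt (fun s : ℝ => (θ, s)) ((0, 1) : ℝ × ℝ) r :=
    (hasDerivAt_const r θ).prodMk (hasDerivAt_id r)
  have h3 := (ContinuousMap.evalCLM ℝ (1 : unitInterval)).hasFDerivAt.comp_hasDerivAt r
    (hS'.comp_hasDerivAt r h2)
  rw [h1]
  refine (twist_of_variation (g' := g')
    (fun x => (hg.differentiable one_ne_zero x).hasDerivAt) (fun x => (abs_le.1 (hM x)).1)
    hL hLM hS hP hS' hP').trans_eq h3.deriv.symm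

end Flow

/-! ### Assembly. -/

theorem Function.Periodic.exists_abs_le {h : ℝ → ℝ} (hper : Function.Periodic h 1)
    (hc : Continuous h) : ∃ C, ∀ x, |h x| ≤ C := by
  obtain ⟨C, hC⟩ := (isCompact_Icc (a := (0 : ℝ)) (b := 1)).exists_bound_of_continuousOn
    hc.continuousOn
  refine ⟨C, fun x => ?_⟩
  obtain ⟨y, hy, hxy⟩ := hper.exists_mem_Ico₀ one_pos x
  rw [hxy]
  exact hC y (Set.Ico_subset_Icc_self hy)

theorem mainTheorem6
    (f g F : ℝ → ℝ) (T : ℝ) (hT : 0 < T)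
    (hg : ContDiff ℝ 7 g) (hg_per : ∀ x, g (x + 1) = g x) (hg_mean : ∫ x in (0 : ℝ)..1, g x = 0)
    (hf : Continuous f) (hf_per : ∀ t, f (t + T) = f t) (hf_mean : ∫ t in (0 : ℝ)..T, f t = 0)
    (hF : ∀ t, HasDerivAt F (f t) t)
    (N : ℕ) (hN : 0 < N) (L : ℝ) (hL : L = T / N)
    -- `L < π / √‖g'‖∞`, without restriction if `g' = 0`
    (hLg : L * Real.sqrt (⨆ x : ℝ, |deriv g x|) < Real.pi)
    (τ : ℝ) :
    (∀ x : ℝ × ℝ, ∃! z : ℝ → ℝ × ℝ, IsSolution F g z ∧ z τ = x) ∧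
      MemTwistClass (-L) L (timeMap F g L τ) := by
  have hFc : Continuous F := continuous_iff_continuousAt.2 fun t => (hF t).continuousAt
  have hLpos : 0 < L := by rw [hL]; positivity
  have hg2 : ContDiff ℝ 2 g := hg.of_le (by norm_num)
  have hg1 : ContDiff ℝ 1 g := hg.of_le (by norm_num)
  have hdper : Function.Periodic (deriv g) 1 := fun x => by
    rw [← deriv_comp_add_const, funext hg_per]
  obtain ⟨C, hC⟩ := Function.Periodic.exists_abs_le hg_per hg.continuous
  obtain ⟨K, hK⟩ := hdper.exists_abs_le (hg1.continuous_deriv le_rfl)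
  have hC' : ∀ x, |g x| ≤ C.toNNReal := fun x => (hC x).trans (Real.le_coe_toNNReal C)
  have hlip : LipschitzWith K.toNNReal g :=
    lipschitzWith_of_nnnorm_deriv_le (hg1.differentiable one_ne_zero) fun x => by
      rw [← NNReal.coe_le_coe, coe_nnnorm]
      exact (hK x).trans (Real.le_coe_toNNReal K)
  have hsup : ∀ x, |deriv g x| ≤ ⨆ x : ℝ, |deriv g x| :=
    le_ciSup ⟨K, Set.forall_mem_range.2 hK⟩
  have hw : WellPosed F g := existsUnique_isSolution hFc hlip hC'
  refine ⟨hw τ, ?_⟩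
  lift g to C(ℝ, ℝ) using hg.continuous
  exact
    { diffeo := hw.isCylinderDiffeo_timeMap hFc hg2 hlip hg_per L τ
      isotopic := hw.isotopicToId_timeMap hFc hg2 hlip hg_per L τ
      exact_symplectic := hw.isExactSymplectic_timeMap hFc hg1 hlip hg_per hg_mean L τ
      twist := hw.isTwist_timeMap hFc hg1 hlip hsup hLpos hLg τ
      preserves_ends := hw.preservesEnds_timeMap hC τ L
      rotation_top := hw.tendstoUniformly_timeMap_atTop hFc hC τ hLpos.le
      rotation_bot := hw.tendstoUniformly_timeMap_atBot hFc hC τ hLpos.le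
      bounded_displacement := ⟨C * |L|, hw.abs_timeMap_snd_sub_le hC τ L⟩ }
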